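/- All graphs are finite, simple and undirected. For a graph $H$ and an integer $k\ge 1$, the Token Jumping graph $\mathsf{TJ}_k(H)$ is the graph whose vertices are the $k$-cliques of $H$ (the sets of $k$ pairwise adjacent vertices), two $k$-cliques $A,B$ being adjacent when $|A\cap B|=k-1$. For a graph $G$ let $$\mathcal K^{\mathsf{TJ}}(G)=\{k\ge 1 : \text{there is a graph } H \text{ with } \mathsf{TJ}_k(H)\cong G\}.$$ The Johnson graph $J(n,r)$ has as vertices the $r$-element subsets of $\{1,\dots,n\}$, two of them being adjacent when their intersection has size $r-1$. Theorem. For every pair of integers $n\ge 2$ and $1\le r\le n-1$, let $s=\min\{r,n-r\}$. Then $$\mathcal K^{\mathsf{TJ}}(J(n,r))=\begin{cases}\{k : k\ge 1\}, & s=1,\\ \{s\}, & s\ge 2\text{ and } n=2s,\\ \{s,n-s\}, & s\ge 2\text{ and } n>2s.\end{cases}$$ -/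

import Mathlib

/-- The Johnson graph `J(n, r)`: its vertices are the `r`-element subsets of an `n`-element set, and
two of them are adjacent when their intersection has size `r - 1`. The condition is written
`|A ∩ B| + 1 = r`, which avoids truncated subtraction and makes loops impossible. -/
def johnsonGraph (n r : ℕ) : SimpleGraph {A : Finset (Fin n) // A.card = r} where
  Adj A B := (A.1 ∩ B.1).card + 1 = r
  symm := ⟨fun A B h => by rwa [Finset.inter_comm]⟩
  loopless := ⟨fun A h => by
    have hA := A.2
    rw [Finset.inter_self] at h
    omega⟩

/-- The Token Jumping reconfiguration graph `TJ_k(H)`: its vertices are the `k`-cliques of `H`, and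
two of them are adjacent when their intersection has size `k - 1`. -/
def tokenJumpingGraph {V : Type*} [DecidableEq V] (k : ℕ) (H : SimpleGraph V) :
    SimpleGraph {A : Finset V // H.IsNClique k A} where
  Adj A B := (A.1 ∩ B.1).card + 1 = k
  symm := ⟨fun A B h => by rwa [Finset.inter_comm]⟩
  loopless := ⟨fun A h => by
    have hA := A.2.card_eq
    rw [Finset.inter_self] at h
    omega⟩

/-- The Token Jumping feasibility set of a target graph `G`: all `k ≥ 1` such that `TJ_k(H)` is
isomorphic to `G` for some finite simple graph `H`. -/
def tokenJumpingFeasible {W : Type*} (G : SimpleGraph W) : Set ℕ :=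
  {k | 1 ≤ k ∧ ∃ (V : Type) (_ : Fintype V) (_ : DecidableEq V) (H : SimpleGraph V),
    Nonempty (tokenJumpingGraph k H ≃g G)}

/-! A triangle `A, B, C` of `TJ_k(H)` is either a star (`A ∩ B ⊆ C`) or consists of `k`-subsets of a
single `(k + 1)`-set. In the second case the `(k + 1)`-set is itself a clique of `H`, and the
triangle has exactly `k - 2` common neighbours (`ncard_commonNeighborsTriple_tokenJumpingGraph`), so
the isomorphism type of the graph reveals `k`.

Let `2 ≤ r ≤ n - 2`. Some edge `AB` of `J(n, r)` lies in triangles of both types whose apexes are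
nonadjacent; they have `n - r - 2` and `r - 2` common neighbours. In `TJ_k(H)` two stars on one edge
have equal or adjacent apexes, so an isomorphism makes at least one of the two a non-star, whence `k
= r` or `k = n - r`. Both values occur: take `H` complete and use complementation. For `s = 1` the
target is complete, and a complete split graph realises every `k`. -/

/-- The vertices adjacent to each of three given vertices. -/
def SimpleGraph.commonNeighborsTriple {V : Type*} (G : SimpleGraph V) (a b c : V) : Set V :=
  {e | G.Adj e a ∧ G.Adj e b ∧ G.Adj e c}

theorem SimpleGraph.Iso.ncard_commonNeighborsTriple {V W : Type*} {G : SimpleGraph V}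
    {G' : SimpleGraph W} (f : G ≃g G') (a b c : V) :
    (G'.commonNeighborsTriple (f a) (f b) (f c)).ncard = (G.commonNeighborsTriple a b c).ncard := by
  have h : G'.commonNeighborsTriple (f a) (f b) (f c) = f '' G.commonNeighborsTriple a b c := by
    ext e
    obtain ⟨e, rfl⟩ := f.surjective e
    rw [f.injective.mem_set_image]
    simp [SimpleGraph.commonNeighborsTriple, f.map_adj_iff]
  rw [h, Set.ncard_image_of_injective _ f.injective]

/-! ### Families of `k`-sets meeting pairwise in `k - 1` points -/

namespace Finset

variable {V : Type*} [DecidableEq V] {k : ℕ} {A B C E : Finset V}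

theorem inter_eq_erase_of_card {z : V} (hA : A.card = k) (hAC : (A ∩ C).card + 1 = k)
    (hz : z ∈ A) (hzC : z ∉ C) : A ∩ C = A.erase z := by
  apply eq_of_subset_of_card_le
  · intro x hx
    rw [mem_inter] at hx
    exact mem_erase.2 ⟨fun h => hzC (h ▸ hx.2), hx.1⟩
  · rw [card_erase_of_mem hz]
    omega

theorem erase_subset_of_card_inter {z : V} (hA : A.card = k) (hAC : (A ∩ C).card + 1 = k)
    (hz : z ∈ A) (hzC : z ∉ C) : A.erase z ⊆ C :=
  inter_eq_erase_of_card hA hAC hz hzC ▸ inter_subset_right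

theorem card_inter_inter_add_two {z : V} (hA : A.card = k) (hAB : (A ∩ B).card + 1 = k)
    (hAC : (A ∩ C).card + 1 = k) (hz : z ∈ A ∩ B) (hzC : z ∉ C) :
    (A ∩ B ∩ C).card + 2 = k := by
  have hzA := (mem_inter.1 hz).1
  have h : A ∩ B ∩ C = (A ∩ B).erase z := by
    have := inter_eq_erase_of_card hA hAC hzA hzC
    rw [inter_right_comm, this, erase_inter]
  have := card_pos.2 ⟨z, hz⟩
  rw [h, card_erase_of_mem hz]
  omega

/-- Here `C` is `A ∪ B` without `z`. A point `u` of `E` outside `A ∪ B` would force `E.erase u`, of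
size `k - 1`, into `A ∩ B ∩ C`, of size `k - 2`. So `E` omits one point of `A ∪ B`, and a set among
`A`, `B`, `C` missing that point would equal `E`. -/
theorem exists_eq_erase_union {z : V} (hA : A.card = k) (hB : B.card = k) (hC : C.card = k)
    (hE : E.card = k) (hAB : (A ∩ B).card + 1 = k) (hAC : (A ∩ C).card + 1 = k)
    (hBC : (B ∩ C).card + 1 = k) (hz : z ∈ A ∩ B) (hzC : z ∉ C)
    (hEA : (E ∩ A).card + 1 = k) (hEB : (E ∩ B).card + 1 = k) (hEC : (E ∩ C).card + 1 = k) :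
    ∃ x ∈ A ∩ B ∩ C, E = (A ∪ B).erase x := by
  have hU : (A ∪ B).card = k + 1 := by
    have := card_union_add_card_inter A B
    omega
  obtain ⟨hzA, hzB⟩ := mem_inter.1 hz
  have hCU : C = (A ∪ B).erase z := by
    symm
    apply eq_of_subset_of_card_le
    · rw [erase_union_distrib]
      exact union_subset (erase_subset_of_card_inter hA hAC hzA hzC)
        (erase_subset_of_card_inter hB hBC hzB hzC)
    · rw [card_erase_of_mem (mem_union_left _ hzA)]
      omega
  have hEU : E ⊆ A ∪ B := by
    intro u hu
    by_contra huU
    have huA : u ∉ A := fun h => huU (mem_union_left _ h)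
    have huB : u ∉ B := fun h => huU (mem_union_right _ h)
    have huC : u ∉ C := fun h => huU (mem_of_mem_erase (hCU ▸ h))
    have hsub : E.erase u ⊆ A ∩ B ∩ C := subset_inter (subset_inter
      (erase_subset_of_card_inter hE hEA hu huA) (erase_subset_of_card_inter hE hEB hu huB))
      (erase_subset_of_card_inter hE hEC hu huC)
    have hle := card_le_card hsub
    have htriple := card_inter_inter_add_two hA hAB hAC hz hzC
    rw [card_erase_of_mem hu] at hle
    omega
  obtain ⟨x, hx⟩ : ∃ x, (A ∪ B) \ E = {x} := by
    rw [← card_eq_one, card_sdiff_of_subset hEU]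
    omega
  have hEx : E = (A ∪ B).erase x := by
    rw [← sdiff_singleton_eq_erase, ← hx, sdiff_sdiff_eq_self hEU]
  have hmem : ∀ D : Finset V, D ⊆ A ∪ B → D.card = k → (E ∩ D).card + 1 = k → x ∈ D := by
    intro D hDU hD hED
    by_contra hxD
    have hDE : D ⊆ E := fun y hy =>
      hEx ▸ mem_erase.2 ⟨fun h => hxD (h ▸ hy), hDU hy⟩
    rw [inter_eq_right.2 hDE] at hED
    omega
  exact ⟨x, mem_inter.2 ⟨mem_inter.2 ⟨hmem A subset_union_left hA hEA,
    hmem B subset_union_right hB hEB⟩, hmem C (hCU ▸ erase_subset _ _) hC hEC⟩, hEx⟩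

end Finset

/-- If three pairwise adjacent `k`-cliques do not share a common `(k - 1)`-set, then their common
neighbours are the other `k`-subsets of their union, which is a clique. -/
theorem ncard_commonNeighborsTriple_tokenJumpingGraph {V : Type*} [DecidableEq V] {k : ℕ}
    {H : SimpleGraph V} {A B C : {A : Finset V // H.IsNClique k A}}
    (hAB : (tokenJumpingGraph k H).Adj A B) (hAC : (tokenJumpingGraph k H).Adj A C)
    (hBC : (tokenJumpingGraph k H).Adj B C) (hABC : ¬ A.1 ∩ B.1 ⊆ C.1) :
    ((tokenJumpingGraph k H).commonNeighborsTriple A B C).ncard + 2 = k := by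
  obtain ⟨A, hA⟩ := A
  obtain ⟨B, hB⟩ := B
  obtain ⟨C, hC⟩ := C
  change (A ∩ B).card + 1 = k at hAB
  change (A ∩ C).card + 1 = k at hAC
  change (B ∩ C).card + 1 = k at hBC
  change ¬ A ∩ B ⊆ C at hABC
  obtain ⟨z, hz, hzC⟩ := Finset.not_subset.1 hABC
  obtain ⟨hzA, hzB⟩ := Finset.mem_inter.1 hz
  have hAzC := Finset.erase_subset_of_card_inter hA.card_eq hAC hzA hzC
  have hBzC := Finset.erase_subset_of_card_inter hB.card_eq hBC hzB hzC
  have hUcard : (A ∪ B).card = k + 1 := by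
    have := Finset.card_union_add_card_inter A B
    have := hA.card_eq
    have := hB.card_eq
    omega
  -- `C` contains every point of `A ∪ B` except `z`, and `z` lies in both `A` and `B`; so any two
  -- points of the union lie together in one of the three cliques.
  have hcross : ∀ p ∈ A, ∀ q ∈ B, p ≠ q → H.Adj p q := by
    intro p hp q hq hpq
    by_cases hqz : q = z
    · exact hA.isClique hp (hqz ▸ hzA) hpq
    by_cases hpz : p = z
    · exact hB.isClique (hpz ▸ hzB) hq hpq
    exact hC.isClique (hAzC (Finset.mem_erase.2 ⟨hpz, hp⟩))
      (hBzC (Finset.mem_erase.2 ⟨hqz, hq⟩)) hpq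
  have hU : H.IsClique (A ∪ B : Finset V) := by
    intro p hp q hq hpq
    rcases Finset.mem_union.1 hp with hp | hp <;> rcases Finset.mem_union.1 hq with hq | hq
    · exact hA.isClique hp hq hpq
    · exact hcross p hp q hq hpq
    · exact (hcross q hq p hp hpq.symm).symm
    · exact hB.isClique hp hq hpq
  have hCU : C ⊆ A ∪ B := by
    have hsub : (A ∪ B).erase z ⊆ C := by
      rw [Finset.erase_union_distrib]
      exact Finset.union_subset hAzC hBzC
    have heq := Finset.eq_of_subset_of_card_le hsub (by
      rw [Finset.card_erase_of_mem (Finset.mem_union_left _ hzA), hC.card_eq]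
      omega)
    exact heq ▸ Finset.erase_subset _ _
  have himage : Subtype.val '' (tokenJumpingGraph k H).commonNeighborsTriple
      ⟨A, hA⟩ ⟨B, hB⟩ ⟨C, hC⟩ = (fun x => (A ∪ B).erase x) '' (A ∩ B ∩ C : Finset V) := by
    ext E
    constructor
    · rintro ⟨⟨E, hE⟩, ⟨hEA, hEB, hEC⟩, rfl⟩
      obtain ⟨x, hx, h⟩ := Finset.exists_eq_erase_union hA.card_eq hB.card_eq hC.card_eq
        hE.card_eq hAB hAC hBC hz hzC hEA hEB hEC
      exact ⟨x, hx, h.symm⟩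
    · rintro ⟨x, hx, rfl⟩
      obtain ⟨⟨hxA, hxB⟩, hxC⟩ : (x ∈ A ∧ x ∈ B) ∧ x ∈ C := by simpa [and_assoc] using hx
      have hinter : ∀ D : Finset V, D ⊆ A ∪ B → D.card = k → x ∈ D →
          ((A ∪ B).erase x ∩ D).card + 1 = k := by
        intro D hDU hD hxD
        rw [Finset.erase_inter, Finset.inter_eq_right.2 hDU, Finset.card_erase_add_one hxD, hD]
      refine ⟨⟨(A ∪ B).erase x, ⟨hU.subset (by simp), ?_⟩⟩,
        ⟨hinter A Finset.subset_union_left hA.card_eq hxA,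
          hinter B Finset.subset_union_right hB.card_eq hxB, hinter C hCU hC.card_eq hxC⟩, rfl⟩
      rw [Finset.card_erase_of_mem (Finset.mem_union_left _ hxA)]
      omega
  rw [← Set.ncard_image_of_injective _ Subtype.val_injective, himage, Set.InjOn.ncard_image,
    Set.ncard_coe_finset, Finset.card_inter_inter_add_two hA.card_eq hAB hAC hz hzC]
  intro x hx y hy hxy
  have hxA : x ∈ A ∪ B := by
    simp only [Finset.coe_inter, Set.mem_inter_iff, Finset.mem_coe] at hx
    exact Finset.mem_union_left _ hx.1.1
  exact Finset.erase_injOn _ hxA (by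
    simp only [Finset.coe_inter, Set.mem_inter_iff, Finset.mem_coe] at hy
    exact Finset.mem_coe.2 (Finset.mem_union_left _ hy.1.1)) hxy

/-! ### Johnson graphs and complementation -/

/-- The Johnson graph is the Token Jumping graph of a complete graph. -/
def tokenJumpingGraphTopIso (n r : ℕ) :
    tokenJumpingGraph r (⊤ : SimpleGraph (Fin n)) ≃g johnsonGraph n r where
  toEquiv := Equiv.subtypeEquivRight fun _ =>
    ⟨fun h => h.card_eq, fun h => ⟨fun _ _ _ _ hne => hne, h⟩⟩
  map_rel_iff' := Iff.rfl

theorem card_compl_inter_compl_add_one_iff {n r : ℕ} (hrn : r ≤ n) {A B : Finset (Fin n)}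
    (hA : A.card = r) (hB : B.card = r) :
    (Aᶜ ∩ Bᶜ).card + 1 = n - r ↔ (A ∩ B).card + 1 = r := by
  have h₁ := Finset.card_union_add_card_inter A B
  have h₂ := Finset.card_add_card_compl (A ∪ B)
  rw [Finset.compl_union, Fintype.card_fin] at h₂
  omega

/-- Complementation identifies `J(n, r)` with `J(n, n - r)`. -/
def johnsonGraphComplIso (n r : ℕ) (hrn : r ≤ n) : johnsonGraph n r ≃g johnsonGraph n (n - r) where
  toFun A := ⟨A.1ᶜ, by rw [Finset.card_compl, A.2, Fintype.card_fin]⟩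
  invFun A := ⟨A.1ᶜ, by rw [Finset.card_compl, A.2, Fintype.card_fin]; omega⟩
  left_inv A := Subtype.ext (compl_compl A.1)
  right_inv A := Subtype.ext (compl_compl A.1)
  map_rel_iff' {A B} := card_compl_inter_compl_add_one_iff hrn A.2 B.2

theorem ncard_commonNeighborsTriple_johnsonGraph {n r : ℕ} {A B C : {A : Finset (Fin n) // A.card = r}}
    (hAB : (johnsonGraph n r).Adj A B) (hAC : (johnsonGraph n r).Adj A C)
    (hBC : (johnsonGraph n r).Adj B C) (hABC : ¬ A.1 ∩ B.1 ⊆ C.1) :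
    ((johnsonGraph n r).commonNeighborsTriple A B C).ncard + 2 = r := by
  rw [← (tokenJumpingGraphTopIso n r).symm.ncard_commonNeighborsTriple]
  exact ncard_commonNeighborsTriple_tokenJumpingGraph hAB hAC hBC hABC

/-- Complementation turns unions into intersections, so it makes this triangle a non-star in `J(n, n
- r)`. -/
theorem ncard_commonNeighborsTriple_johnsonGraph_of_not_subset_union {n r : ℕ} (hrn : r ≤ n)
    {A B C : {A : Finset (Fin n) // A.card = r}}
    (hAB : (johnsonGraph n r).Adj A B) (hAC : (johnsonGraph n r).Adj A C)
    (hBC : (johnsonGraph n r).Adj B C) (hABC : ¬ C.1 ⊆ A.1 ∪ B.1) :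
    ((johnsonGraph n r).commonNeighborsTriple A B C).ncard + 2 = n - r := by
  let f := johnsonGraphComplIso n r hrn
  rw [← f.ncard_commonNeighborsTriple]
  refine ncard_commonNeighborsTriple_johnsonGraph (f.map_adj_iff.2 hAB) (f.map_adj_iff.2 hAC)
    (f.map_adj_iff.2 hBC) ?_
  change ¬ A.1ᶜ ∩ B.1ᶜ ⊆ C.1ᶜ
  rwa [← Finset.compl_union, Finset.compl_subset_compl]

/-- Two triangles sharing an edge `AB` of `J(n, r)`, of different types, with nonadjacent apexes. -/
theorem exists_triangles_johnsonGraph {n r : ℕ} (hr : 2 ≤ r) (hrn : r + 2 ≤ n) :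
    ∃ A B C D : {A : Finset (Fin n) // A.card = r},
      (johnsonGraph n r).Adj A B ∧ (johnsonGraph n r).Adj A C ∧ (johnsonGraph n r).Adj B C ∧
      (johnsonGraph n r).Adj A D ∧ (johnsonGraph n r).Adj B D ∧ C ≠ D ∧
      ¬ (johnsonGraph n r).Adj C D ∧ ¬ C.1 ⊆ A.1 ∪ B.1 ∧ ¬ A.1 ∩ B.1 ⊆ D.1 := by
  -- Split an `(r + 2)`-set into four points `x, a, b, c` and a set `Y` of size `r - 2`. The
  -- witnesses add to `Y` the pairs `xa`, `xb`, `xc`, `ab`: the first three form a star at `x`,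
  -- while `xa, xb, ab` is a non-star, and the pairs `xc`, `ab` are disjoint.
  obtain ⟨Z, -, hZ⟩ := Finset.exists_subset_card_eq
    (s := (Finset.univ : Finset (Fin n))) (n := r + 2) (by simpa using hrn)
  obtain ⟨x, Z₁, hx, rfl, hZ₁⟩ := Finset.card_eq_succ.1 (show Z.card = (r + 1) + 1 by omega)
  obtain ⟨a, Z₂, ha, rfl, hZ₂⟩ := Finset.card_eq_succ.1 hZ₁
  obtain ⟨b, Z₃, hb, rfl, hZ₃⟩ := Finset.card_eq_succ.1 (show Z₂.card = (r - 1) + 1 by omega)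
  obtain ⟨c, Y, hc, rfl, hY⟩ := Finset.card_eq_succ.1 (show Z₃.card = (r - 2) + 1 by omega)
  simp only [Finset.mem_insert, not_or] at hx ha hb
  obtain ⟨hxa, hxb, hxc, hxY⟩ := hx
  obtain ⟨hab, hac, haY⟩ := ha
  obtain ⟨hbc, hbY⟩ := hb
  have hcard : ∀ p q : Fin n, p ≠ q → p ∉ Y → q ∉ Y → (insert p (insert q Y)).card = r := by
    intro p q hpq hp hq
    rw [Finset.card_insert_of_notMem (by simp [hpq, hp]), Finset.card_insert_of_notMem hq]
    omega
  have hadj : ∀ p q t : Fin n, p ≠ q → p ≠ t → q ≠ t → p ∉ Y → q ∉ Y → t ∉ Y →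
      (insert p (insert q Y) ∩ insert p (insert t Y)).card + 1 = r := by
    intro p q t hpq hpt hqt hp hq ht
    have : insert p (insert q Y) ∩ insert p (insert t Y) = insert p Y := by
      rw [← Finset.insert_inter_distrib, Finset.insert_inter_of_notMem (by simp [hqt, hq]),
        Finset.inter_eq_left.2 (Finset.subset_insert _ _)]
    rw [this, Finset.card_insert_of_notMem hp]
    omega
  have hne : ∃ y, y ∈ insert x (insert c Y) ∧ y ∉ insert a (insert b Y) :=
    ⟨x, by simp, by simp [hxa, hxb, hxY]⟩
  refine ⟨⟨_, hcard x a hxa hxY haY⟩, ⟨_, hcard x b hxb hxY hbY⟩, ⟨_, hcard x c hxc hxY hc⟩,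
    ⟨_, hcard a b hab haY hbY⟩, hadj x a b hxa hxb hab hxY haY hbY,
    hadj x a c hxa hxc hac hxY haY hc, hadj x b c hxb hxc hbc hxY hbY hc, ?_, ?_, ?_, ?_, ?_, ?_⟩
  · change (insert x (insert a Y) ∩ insert a (insert b Y)).card + 1 = r
    rw [Finset.insert_comm x a]
    exact hadj a x b (Ne.symm hxa) hab hxb haY hxY hbY
  · change (insert x (insert b Y) ∩ insert a (insert b Y)).card + 1 = r
    rw [Finset.insert_comm x b, Finset.insert_comm a b]
    exact hadj b x a (Ne.symm hxb) (Ne.symm hab) hxa hbY hxY haY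
  · intro h
    obtain ⟨y, hy, hy'⟩ := hne
    have h : insert x (insert c Y) = insert a (insert b Y) := Subtype.ext_iff.1 h
    exact hy' (h ▸ hy)
  · change ¬ (insert x (insert c Y) ∩ insert a (insert b Y)).card + 1 = r
    have : insert x (insert c Y) ∩ insert a (insert b Y) = Y := by
      rw [Finset.insert_inter_of_notMem (by simp [hxa, hxb, hxY]),
        Finset.insert_inter_of_notMem (by simp [Ne.symm hac, Ne.symm hbc, hc])]
      exact Finset.inter_eq_left.2 ((Finset.subset_insert _ _).trans (Finset.subset_insert _ _))
    rw [this]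
    omega
  · exact fun h => absurd (h (show c ∈ insert x (insert c Y) by simp))
      (by simp [Ne.symm hxc, Ne.symm hac, Ne.symm hbc, hc])
  · exact fun h => absurd (h (show x ∈ insert x (insert a Y) ∩ insert x (insert b Y) by simp))
      (by simp [hxa, hxb, hxY])

/-! ### The feasible values for `2 ≤ r ≤ n - 2` -/

/-- `C` and `D` share the `(k - 1)`-set `A ∩ B`. This is what prevents both chosen triangles from
being stars. -/
theorem tokenJumpingGraph_eq_or_adj_of_inter_subset {V : Type*} [DecidableEq V] {k : ℕ}
    {H : SimpleGraph V} {A B C D : {A : Finset V // H.IsNClique k A}}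
    (hAB : (tokenJumpingGraph k H).Adj A B) (hC : A.1 ∩ B.1 ⊆ C.1) (hD : A.1 ∩ B.1 ⊆ D.1) :
    C = D ∨ (tokenJumpingGraph k H).Adj C D := by
  change (A.1 ∩ B.1).card + 1 = k at hAB
  have hle := Finset.card_le_card (Finset.subset_inter hC hD)
  by_cases h : (C.1 ∩ D.1).card + 1 = k
  · exact Or.inr h
  · left
    have hCcard := C.2.card_eq
    have hDcard := D.2.card_eq
    have hCD := Finset.eq_of_subset_of_card_le
      (Finset.inter_subset_left : C.1 ∩ D.1 ⊆ C.1) (by omega)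
    exact Subtype.ext (Finset.eq_of_subset_of_card_le (Finset.inter_eq_left.1 hCD) (by omega))

theorem eq_or_eq_of_mem_tokenJumpingFeasible_johnsonGraph {n r k : ℕ} (hr : 2 ≤ r)
    (hrn : r + 2 ≤ n) (hk : k ∈ tokenJumpingFeasible (johnsonGraph n r)) : k = r ∨ k = n - r := by
  obtain ⟨-, V, _, _, H, ⟨e⟩⟩ := hk
  obtain ⟨A, B, C, D, hAB, hAC, hBC, hAD, hBD, hne, hCD, hC, hD⟩ :=
    exists_triangles_johnsonGraph hr hrn
  let f := e.symm
  have hAB' := f.map_adj_iff.2 hAB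
  by_cases hC' : (f A).1 ∩ (f B).1 ⊆ (f C).1
  · by_cases hD' : (f A).1 ∩ (f B).1 ⊆ (f D).1
    · rcases tokenJumpingGraph_eq_or_adj_of_inter_subset hAB' hC' hD' with h | h
      · exact absurd (f.injective h) hne
      · exact absurd (f.map_adj_iff.1 h) hCD
    · left
      rw [← ncard_commonNeighborsTriple_tokenJumpingGraph hAB' (f.map_adj_iff.2 hAD)
        (f.map_adj_iff.2 hBD) hD', f.ncard_commonNeighborsTriple,
        ncard_commonNeighborsTriple_johnsonGraph hAB hAD hBD hD]
  · right
    rw [← ncard_commonNeighborsTriple_tokenJumpingGraph hAB' (f.map_adj_iff.2 hAC)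
      (f.map_adj_iff.2 hBC) hC', f.ncard_commonNeighborsTriple,
      ncard_commonNeighborsTriple_johnsonGraph_of_not_subset_union (by omega) hAB hAC hBC hC]

theorem self_mem_tokenJumpingFeasible_johnsonGraph {n r : ℕ} (hr : 1 ≤ r) :
    r ∈ tokenJumpingFeasible (johnsonGraph n r) :=
  ⟨hr, Fin n, inferInstance, inferInstance, ⊤, ⟨tokenJumpingGraphTopIso n r⟩⟩

theorem tokenJumpingFeasible_congr {W W' : Type*} {G : SimpleGraph W} {G' : SimpleGraph W'}
    (f : G ≃g G') : tokenJumpingFeasible G = tokenJumpingFeasible G' := by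
  ext k
  constructor
  · rintro ⟨hk, V, i, j, H, ⟨e⟩⟩
    exact ⟨hk, V, i, j, H, ⟨e.trans f⟩⟩
  · rintro ⟨hk, V, i, j, H, ⟨e⟩⟩
    exact ⟨hk, V, i, j, H, ⟨e.trans f.symm⟩⟩

theorem sub_mem_tokenJumpingFeasible_johnsonGraph {n r : ℕ} (hrn : r + 1 ≤ n) :
    n - r ∈ tokenJumpingFeasible (johnsonGraph n r) := by
  rw [tokenJumpingFeasible_congr (johnsonGraphComplIso n r (by omega))]
  exact self_mem_tokenJumpingFeasible_johnsonGraph (by omega)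

/-- The join of a complete graph on `α` and an edgeless graph on `β`. -/
def completeSplitGraph (α β : Type*) : SimpleGraph (α ⊕ β) where
  Adj u v := u ≠ v ∧ (u.isLeft ∨ v.isLeft)
  symm := ⟨fun _ _ h => ⟨h.1.symm, h.2.symm⟩⟩
  loopless := ⟨fun _ h => h.1 rfl⟩

section completeSplitGraph

variable {α β : Type*} [Fintype α]

theorem isNClique_completeSplitGraph_cons (b : β) :
    (completeSplitGraph α β).IsNClique (Fintype.card α + 1)
      (Finset.univ.disjSum {b} : Finset (α ⊕ β)) := by
  refine ⟨?_, by simp⟩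
  rintro (u | u) hu (v | v) hv huv
  · exact ⟨huv, Or.inl rfl⟩
  · exact ⟨huv, Or.inl rfl⟩
  · exact ⟨huv, Or.inr rfl⟩
  · simp only [Finset.mem_coe, Finset.inr_mem_disjSum, Finset.mem_singleton] at hu hv
    exact absurd (hu ▸ hv ▸ rfl) huv

/-- The `β` side is independent, so a clique has at most one point there; its size then forces
exactly one, together with all of `α`. -/
theorem exists_eq_of_isNClique_completeSplitGraph {A : Finset (α ⊕ β)}
    (hA : (completeSplitGraph α β).IsNClique (Fintype.card α + 1) A) :
    ∃ b, A = Finset.univ.disjSum {b} := by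
  have hsum := Finset.card_toLeft_add_card_toRight (u := A)
  have hright : A.toRight.card ≤ 1 := by
    rw [Finset.card_le_one]
    intro u hu v hv
    by_contra huv
    have := hA.isClique (Finset.mem_coe.2 (Finset.mem_toRight.1 hu))
      (Finset.mem_coe.2 (Finset.mem_toRight.1 hv)) (by simpa using huv)
    simpa using this.2
  have hleft := Finset.card_le_univ A.toLeft
  rw [hA.card_eq] at hsum
  obtain ⟨b, hb⟩ := Finset.card_eq_one.1 (show A.toRight.card = 1 by omega)
  have huniv := (Finset.card_eq_iff_eq_univ A.toLeft).1 (by omega)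
  exact ⟨b, by rw [← huniv, ← hb, Finset.toLeft_disjSum_toRight]⟩

variable (α β) [DecidableEq α] [DecidableEq β]

/-- The Token Jumping graph of a complete split graph, one level above the complete part, is
complete. -/
noncomputable def tokenJumpingGraphCompleteSplitIso :
    (⊤ : SimpleGraph β) ≃g
      tokenJumpingGraph (Fintype.card α + 1) (completeSplitGraph α β) where
  toEquiv := Equiv.ofBijective
    (fun b => ⟨Finset.univ.disjSum {b}, isNClique_completeSplitGraph_cons b⟩) (by
      constructor
      · intro b c h
        have h : (Finset.univ.disjSum {b} : Finset (α ⊕ β)) = Finset.univ.disjSum {c} :=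
          Subtype.ext_iff.1 h
        have : Sum.inr b ∈ (Finset.univ.disjSum {c} : Finset (α ⊕ β)) := by
          rw [← h]
          simp
        simpa using this
      · rintro ⟨A, hA⟩
        obtain ⟨b, rfl⟩ := exists_eq_of_isNClique_completeSplitGraph hA
        exact ⟨b, rfl⟩)
  map_rel_iff' {b c} := by
    change ((Finset.univ.disjSum {b} ∩ Finset.univ.disjSum {c} : Finset (α ⊕ β)).card + 1 =
      Fintype.card α + 1) ↔ b ≠ c
    have h : (Finset.univ.disjSum {b} ∩ Finset.univ.disjSum {c} : Finset (α ⊕ β)) =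
        Finset.univ.disjSum ({b} ∩ {c}) := by
      ext (u | u) <;> simp
    rw [h, Finset.card_disjSum, Finset.card_univ]
    by_cases hbc : b = c
    · simp [hbc]
    · simp [hbc]

end completeSplitGraph

/-- `J(n, 1)` is a complete graph. -/
noncomputable def topIsoJohnsonGraphOne (n : ℕ) : (⊤ : SimpleGraph (Fin n)) ≃g johnsonGraph n 1 where
  toEquiv := Equiv.ofBijective (fun b => ⟨{b}, Finset.card_singleton b⟩) (by
    constructor
    · intro b c h
      simpa using Subtype.ext_iff.1 h
    · rintro ⟨A, hA⟩
      obtain ⟨b, rfl⟩ := Finset.card_eq_one.1 hA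
      exact ⟨b, rfl⟩)
  map_rel_iff' {b c} := by
    change (({b} ∩ {c} : Finset (Fin n)).card + 1 = 1) ↔ b ≠ c
    by_cases hbc : b = c <;> simp [hbc]

theorem tokenJumpingFeasible_johnsonGraph_one (n : ℕ) :
    tokenJumpingFeasible (johnsonGraph n 1) = {k : ℕ | 1 ≤ k} := by
  rw [← tokenJumpingFeasible_congr (topIsoJohnsonGraphOne n)]
  ext k
  refine ⟨fun h => h.1, fun hk => ?_⟩
  -- The complete part gets one vertex fewer than the clique size, hence none for cliques of size
  -- one.
  obtain ⟨k, rfl⟩ := Nat.exists_eq_add_of_le' (show 1 ≤ k from hk)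
  have e := (tokenJumpingGraphCompleteSplitIso (Fin k) (Fin n)).symm
  rw [Fintype.card_fin] at e
  exact ⟨hk, Fin k ⊕ Fin n, inferInstance, inferInstance, completeSplitGraph _ _, ⟨e⟩⟩

theorem tokenJumpingFeasible_johnsonGraph {n r : ℕ} (hr : 2 ≤ r) (hrn : r + 2 ≤ n) :
    tokenJumpingFeasible (johnsonGraph n r) = {r, n - r} := by
  ext k
  constructor
  · exact eq_or_eq_of_mem_tokenJumpingFeasible_johnsonGraph hr hrn
  · rintro (rfl | rfl)
    · exact self_mem_tokenJumpingFeasible_johnsonGraph (by omega)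
    · exact sub_mem_tokenJumpingFeasible_johnsonGraph (by omega)

theorem mainTheorem2 (n r s : ℕ) (hn : 2 ≤ n) (hr : 1 ≤ r) (hrn : r ≤ n - 1)
    (hs : s = min r (n - r)) :
    (s = 1 → tokenJumpingFeasible (johnsonGraph n r) = {k : ℕ | 1 ≤ k}) ∧
    (2 ≤ s → n = 2 * s → tokenJumpingFeasible (johnsonGraph n r) = {s}) ∧
    (2 ≤ s → 2 * s < n → tokenJumpingFeasible (johnsonGraph n r) = {s, n - s}) := by
  have hcompl := tokenJumpingFeasible_congr (johnsonGraphComplIso n r (by omega))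
  -- Replacing `r` by `s` gives `s ≤ n - s`, so `s ≥ 2` alone yields `s + 2 ≤ n`.
  have hJ : tokenJumpingFeasible (johnsonGraph n r) = tokenJumpingFeasible (johnsonGraph n s) := by
    rcases min_choice r (n - r) with h | h
    · rw [hs, h]
    · rw [hs, h, hcompl]
  rw [hJ]
  refine ⟨?_, fun h2 hns => ?_, fun h2 hns => tokenJumpingFeasible_johnsonGraph h2 (by omega)⟩
  · rintro rfl
    exact tokenJumpingFeasible_johnsonGraph_one n
  · rw [tokenJumpingFeasible_johnsonGraph h2 (by omega), show n - s = s by omega,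
      Set.pair_eq_singleton]
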